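/- Units $c=k_B=\hbar=1$. Consider a relativistic gas of classical particles of mass $m\ge 0$ in the uniform equilibrium state $f^{eq}_p=e^{(\mu-p^0)/T}$, with $T>0$, $\mu\in\mathbb R$, $p^0=\sqrt{m^2+|p|^2}$. Let $\varepsilon=\int\frac{d^3p}{(2\pi)^3}f^{eq}_p\,p^0$ and $P=\int\frac{d^3p}{(2\pi)^3}f^{eq}_p\,(p^1)^2/p^0$ be its energy density and pressure. Perturbations $f_p=f^{eq}_p(1+\phi_p)$ live in $\mathcal H=L^2(\mathbb R^3,f^{eq}_p\,d^3p/(2\pi)^3)$ with inner product $(\cdot,\cdot)$, and plane waves $\phi_p\,e^{i(kx_1-\omega t)}$ with $\omega,k\in\mathbb C$ obey the linearised kinetic equation $$(I+ik\,v^1)\phi=i\omega\,\phi,\qquad v^1=p^1/p^0 .$$ The linearised collision operator $I$ is assumed to be a (possibly unbounded) self-adjoint operator on $\mathcal H$ such that $(\phi,I\phi)\ge0$ for all $\phi$ in its domain, $I\phi=0$ if and only if $\phi\in\mathrm{span}\{1,p^0,p^1,p^2,p^3\}$, and $I$ commutes with the rotations of momentum space. Assume that the non-hydrodynamic sector has a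 finite gap $\omega_g=-i/\tau_g$ at $k=0$: the spectrum of the restriction of $I$ to $\{1,p^0,p^1,p^2,p^3\}^{\perp}$ has infimum $1/\tau_g$, with $0<\tau_g<\infty$. A hydrodynamic shear wave of circular polarisation $s=\pm1$ is a pair $(\omega(k),\phi(k))$, analytic at $k=0$, that solves the linearised kinetic equation for all complex $k$ near $0$, with $\omega(0)=0$, $\phi(0)\neq0$, and $\phi_{\mathcal R(\theta)p}(k)=e^{is\theta}\phi_p(k)$ for the rotations $\mathcal R(\theta)$ around axis 1. A real number $\eta$ is the shear viscosity if, in every shear wave of either polarisation, as $k\to0$, $$\pi^{12}=-\eta\,(ik)\,u^2+O(k^2),\qquad \omega(k)=-\,\frac{i\,\eta}{\varepsilon+P}\,k^2+O(k^3),$$ where $\pi^{12}=(p^1p^2/p^0,\phi(k))$ and $u^2=(p^2,\phi(k))/(\varepsilon+P)$. Then shear waves of both polarisations exist, there is exactly one (finite, real) shear viscosity $\eta$, and $$\eta\;\le\;\frac{32}{3\pi}\,(\varepsilon+P)\,\tau_g .$$ -/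

import Mathlib

open MeasureTheory Filter Topology
open scoped InnerProductSpace

noncomputable section

/-! ### Unbounded operators: spectrum and part in a subspace -/

namespace KineticGas

/-- `z` is in the resolvent set of the (possibly unbounded) operator `A` if `A - z` maps the domain
of `A` bijectively onto the whole space, with a bounded inverse `R`. -/
def InResolventSet {E : Type*} [NormedAddCommGroup E] [NormedSpace ℂ E]
    (A : E →ₗ.[ℂ] E) (z : ℂ) : Prop :=
  ∃ R : E →L[ℂ] E,
    (∀ y : E, ∃ h : R y ∈ A.domain, A ⟨R y, h⟩ - z • R y = y) ∧
    (∀ x : A.domain, R (A x - z • (x : E)) = x)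

/-- The spectrum of a (possibly unbounded) operator: the complement of its resolvent set. -/
def spectrumPMap {E : Type*} [NormedAddCommGroup E] [NormedSpace ℂ E]
    (A : E →ₗ.[ℂ] E) : Set ℂ :=
  {z | ¬ InResolventSet A z}

/-- The part (restriction) of the operator `A` in the subspace `S`: it acts as `A` on the vectors
of `S ∩ dom A` that `A` maps into `S`. -/
def partIn {E : Type*} [NormedAddCommGroup E] [NormedSpace ℂ E]
    (A : E →ₗ.[ℂ] E) (S : Submodule ℂ E) : S →ₗ.[ℂ] S where
  domain :=
    { carrier := {x | ∃ h : (x : E) ∈ A.domain, A ⟨x, h⟩ ∈ S}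
      add_mem' := by
        rintro x y ⟨hx, hx'⟩ ⟨hy, hy'⟩
        refine ⟨A.domain.add_mem hx hy, ?_⟩
        have := S.add_mem hx' hy'
        rwa [← A.map_add] at this
      zero_mem' := ⟨A.domain.zero_mem, by
        have : A ⟨((0 : S) : E), A.domain.zero_mem⟩ = 0 := A.map_zero
        rw [this]; exact S.zero_mem⟩
      smul_mem' := by
        rintro c x ⟨hx, hx'⟩
        refine ⟨A.domain.smul_mem c hx, ?_⟩
        have := S.smul_mem c hx'
        rwa [← A.map_smul] at this }
  toFun :=
    { toFun := fun x => ⟨A ⟨x.1, x.2.choose⟩, x.2.choose_spec⟩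
      map_add' := fun x y => Subtype.ext (A.map_add ⟨_, x.2.choose⟩ ⟨_, y.2.choose⟩)
      map_smul' := fun c x => Subtype.ext (A.map_smul c ⟨_, x.2.choose⟩) }

/-! ### The equilibrium state and the Hilbert space -/

/-- Data of a uniform static equilibrium state of a relativistic gas of classical particles (units
`c = k_B = ħ = 1`): particle mass `m`, temperature `T`, chemical potential `μ`. -/
structure Equilibrium where
  m : ℝ
  T : ℝ
  μ : ℝ
  m_nonneg : 0 ≤ m
  T_pos : 0 < T

/-- Momentum space `ℝ³`; the coordinates `0, 1, 2` of a vector are its components `p¹, p², p³`. -/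
abbrev Mom : Type := Fin 3 → ℝ

namespace Equilibrium

variable (G : Equilibrium)

/-- The particle energy `p⁰ = √(m² + |p|²)`. -/
def energy (p : Mom) : ℝ := Real.sqrt (G.m ^ 2 + ∑ i, p i ^ 2)

/-- The equilibrium distribution `f^eq_p = exp ((μ - p⁰) / T)`. -/
def feq (p : Mom) : ℝ := Real.exp ((G.μ - G.energy p) / G.T)

/-- The velocity `v¹ = p¹ / p⁰` in direction 1. -/
def v1 (p : Mom) : ℝ := p 0 / G.energy p

/-- The measure `f^eq_p d³p / (2π)³`. -/
def eqMeasure : Measure Mom :=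
  volume.withDensity fun p => ENNReal.ofReal (G.feq p / (2 * Real.pi) ^ 3)

/-- The Hilbert space `L²(ℝ³, f^eq_p d³p / (2π)³)` of complex perturbations `φ_p`,
where `f_p = f^eq_p (1 + φ_p)`. -/
abbrev H : Type := Lp ℂ 2 G.eqMeasure

/-- The equilibrium energy density `ε = ∫ d³p/(2π)³ f^eq p⁰`. -/
def energyDensity : ℝ := ∫ p, G.energy p ∂G.eqMeasure

/-- The equilibrium pressure `P = ∫ d³p/(2π)³ f^eq (p¹)² / p⁰`. -/
def pressure : ℝ := ∫ p, p 0 ^ 2 / G.energy p ∂G.eqMeasure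

/-- The relativistic enthalpy density `ε + P`. -/
def enthalpyDensity : ℝ := G.energyDensity + G.pressure

/-- The space `span {1, p⁰, p¹, p², p³}` of the summational invariants `a + b_ν p^ν`. -/
def hydro : Submodule ℂ G.H where
  carrier := {φ | ∃ (a b₀ : ℂ) (b : Fin 3 → ℂ), ∀ᵐ p ∂G.eqMeasure,
    (φ : Mom → ℂ) p = a + b₀ * (G.energy p : ℂ) + ∑ i, b i * (p i : ℂ)}
  add_mem' := by
    rintro φ ψ ⟨a, b₀, b, h⟩ ⟨a', b₀', b', h'⟩
    refine ⟨a + a', b₀ + b₀', b + b', ?_⟩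
    filter_upwards [h, h', Lp.coeFn_add φ ψ] with p h1 h2 h3
    rw [h3, Pi.add_apply, h1, h2]
    simp only [Pi.add_apply, add_mul, Finset.sum_add_distrib]
    ring
  zero_mem' := by
    refine ⟨0, 0, 0, ?_⟩
    filter_upwards [Lp.coeFn_zero ℂ 2 G.eqMeasure] with p h
    rw [h]; simp
  smul_mem' := by
    rintro c φ ⟨a, b₀, b, h⟩
    refine ⟨c * a, c * b₀, c • b, ?_⟩
    filter_upwards [h, Lp.coeFn_smul c φ] with p h1 h2
    rw [h2, Pi.smul_apply, h1]
    simp only [Pi.smul_apply, smul_eq_mul, mul_add, Finset.mul_sum, mul_assoc]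

/-- The space of the non-hydrodynamic perturbations: those with `(1, φ) = 0` and `(p^ν, φ) = 0`. -/
abbrev nonHydro : Submodule ℂ G.H := G.hydroᗮ

/-! ### The linearised collision operator -/

/-- `J` is the linearised collision operator of a relativistic kinetic theory that is consistent with
thermodynamics: a self-adjoint (hence densely defined), non-negative operator whose kernel
consists exactly of the summational invariants `a + b_ν p^ν`, and which commutes with the
rotations of momentum space (Lorentz invariance of the theory, isotropy of the equilibrium). The
linearised kinetic equation is `∂_t φ + v · ∇φ = - J φ`. -/
structure IsCollisionOperator (J : G.H →ₗ.[ℂ] G.H) : Prop where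
  selfAdjoint : IsSelfAdjoint J
  nonneg : ∀ φ : J.domain, 0 ≤ (⟪(φ : G.H), J φ⟫_ℂ).re
  ker_iff : ∀ φ : G.H, (∃ h : φ ∈ J.domain, J ⟨φ, h⟩ = 0) ↔ φ ∈ G.hydro
  rotation : ∀ Q ∈ Matrix.specialOrthogonalGroup (Fin 3) ℝ, ∀ (φ : J.domain) (ψ : G.H),
    (∀ᵐ p ∂G.eqMeasure, (ψ : Mom → ℂ) p = ((φ : G.H) : Mom → ℂ) (Q.mulVec p)) →
    ∃ h : ψ ∈ J.domain, ∀ᵐ p ∂G.eqMeasure,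
      (J ⟨ψ, h⟩ : Mom → ℂ) p = (J φ : Mom → ℂ) (Q.mulVec p)

/-- At `k = 0` the non-hydrodynamic sector has the finite gap `ω_g = -i / τ_g`: the bottom of the
spectrum of the collision operator in the non-hydrodynamic space is `1 / τ_g > 0`. -/
def HasGap (J : G.H →ₗ.[ℂ] G.H) (τg : ℝ) : Prop :=
  0 < τg ∧ IsGLB {x : ℝ | (x : ℂ) ∈ spectrumPMap (partIn J G.nonHydro)} (1 / τg)

/-! ### Shear waves and the shear viscosity -/

/-- The rotation by the angle `θ` around axis 1. -/
def rotAxis1 (θ : ℝ) : Matrix (Fin 3) (Fin 3) ℝ :=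
  !![1, 0, 0; 0, Real.cos θ, -Real.sin θ; 0, Real.sin θ, Real.cos θ]

/-- `(ω, φ)` is a hydrodynamic shear wave `φ_p(k) e^{i (k x₁ - ω(k) t)}` with circular polarisation
`s = ±1`: the frequency and the state are analytic at `k = 0`, `ω(0) = 0`, `φ(0) ≠ 0`, and for
all complex `k` near `0` the state solves the linearised kinetic equation
`(J + i k v¹) φ = i ω φ` and has spin `s` around the direction of propagation. -/
structure IsShearWave (J : G.H →ₗ.[ℂ] G.H) (s : ℤ) (ω : ℂ → ℂ) (φ : ℂ → G.H) : Prop where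
  analytic_freq : AnalyticAt ℂ ω 0
  analytic_state : AnalyticAt ℂ φ 0
  freq_zero : ω 0 = 0
  state_ne_zero : φ 0 ≠ 0
  kinetic_eq : ∀ᶠ k in 𝓝 (0 : ℂ), ∃ h : φ k ∈ J.domain, ∀ᵐ p ∂G.eqMeasure,
    (J ⟨φ k, h⟩ : Mom → ℂ) p + Complex.I * k * (G.v1 p : ℂ) * (φ k : Mom → ℂ) p
      = Complex.I * ω k * (φ k : Mom → ℂ) p
  spin : ∀ᶠ k in 𝓝 (0 : ℂ), ∀ θ : ℝ, ∀ᵐ p ∂G.eqMeasure,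
    (φ k : Mom → ℂ) ((rotAxis1 θ).mulVec p)
      = Complex.exp (Complex.I * s * θ) * (φ k : Mom → ℂ) p

/-- The perturbation `δT⁰² = (p², φ)` of the density of momentum in direction 2. -/
def momentumDensity2 (φ : G.H) : ℂ := ∫ p, (p 1 : ℂ) * (φ : Mom → ℂ) p ∂G.eqMeasure

/-- The perturbation `δT¹² = π¹² = (p¹ p² / p⁰, φ)` of the shear stress. -/
def shearStress12 (φ : G.H) : ℂ :=
  ∫ p, ((p 0 * p 1 / G.energy p : ℝ) : ℂ) * (φ : Mom → ℂ) p ∂G.eqMeasure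

/-- The perturbation `u² = δT⁰² / (ε + P)` of the flow velocity in direction 2. -/
def flowVelocity2 (φ : G.H) : ℂ := G.momentumDensity2 φ / (G.enthalpyDensity : ℂ)

/-- `η` is the shear viscosity: in every shear wave the stress obeys, to first order in gradients,
the Navier-Stokes law `π¹² = - η ∂₁u²` (with `∂₁ = i k`), and the dispersion relation is
`ω(k) = - i η k² / (ε + P) + O(k³)`. -/
def IsShearViscosity (J : G.H →ₗ.[ℂ] G.H) (η : ℝ) : Prop :=
  ∀ (s : ℤ) (ω : ℂ → ℂ) (φ : ℂ → G.H), (s = 1 ∨ s = -1) → G.IsShearWave J s ω φ →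
    ((fun k : ℂ => G.shearStress12 (φ k) + (η : ℂ) * (Complex.I * k * G.flowVelocity2 (φ k)))
      =O[𝓝 0] fun k : ℂ => k ^ 2) ∧
    ((fun k : ℂ => ω k + Complex.I * (η : ℂ) / (G.enthalpyDensity : ℂ) * k ^ 2)
      =O[𝓝 0] fun k : ℂ => k ^ 3)

end Equilibrium

end KineticGas

end

/-! This is degenerate perturbation theory at the eigenvalue `0` of `J`. Fixing the spin `s = ±1`
around axis 1 removes the degeneracy: the only summational invariants of that spin are multiples of
χ = p² + i s p³ (`exists_eq_smul_shearMode`). The gap provides an inverse `K` of `J` on the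
non-hydrodynamic space, extended by zero, with ‖K‖ ≤ τ_g (`exists_isReducedResolvent`); `K` commutes
with rotations, so it preserves the spin.

Splitting φ into a multiple of χ and a non-hydrodynamic part ψ, the kinetic equation gives ψ = K(iωφ
- ik v¹φ) = O(k). Since (χ, v¹χ) = 0 by parity, the momentum flux (χ, v¹φ) comes from ψ alone and
equals -ik d (χ, φ) + O(k²), with d = (v¹χ, K v¹χ)/(χ, χ) (`IsShearWave.flux_isBigO`). Conservation
of momentum, k (χ, v¹φ) = ω (χ, φ), then gives ω = -i d k² + O(k³), so that η = (ε + P) d. Existence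
of the waves is a Lyapunov–Schmidt reduction solved by the analytic implicit function theorem.

The bound is Cauchy–Schwarz: |v¹| ≤ 1 and ‖K‖ ≤ τ_g give d ≤ τ_g. Thus η ≤ (ε + P) τ_g, which is
stronger than the claim because 32/(3π) ≥ 1. -/

noncomputable section

namespace KineticGas

/-! ### Reduced resolvent of a self-adjoint operator with a spectral gap -/

section Abstract

variable {E : Type*} [NormedAddCommGroup E] [InnerProductSpace ℂ E] [CompleteSpace E]

/-- A symmetric operator without spectrum in `(-∞, 1/τ)` has a symmetric inverse of norm at most
`τ`. -/
theorem exists_symmetric_inverse (L : E →ₗ.[ℂ] E)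
    (hsym : ∀ x y : L.domain, ⟪L x, (y : E)⟫_ℂ = ⟪(x : E), L y⟫_ℂ) {τ : ℝ} (hτ : 0 < τ)
    (hres : ∀ x : ℝ, x < 1 / τ → InResolventSet L (x : ℂ)) :
    ∃ R : E →L[ℂ] E, (∀ y : E, ∃ h : R y ∈ L.domain, L ⟨R y, h⟩ = y) ∧
      (∀ x : L.domain, R (L x) = x) ∧ (∀ x y : E, ⟪R x, y⟫_ℂ = ⟪x, R y⟫_ℂ) ∧ ‖R‖ ≤ τ := by
  obtain ⟨R, hR1, hR2⟩ := hres 0 (by positivity)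
  simp only [Complex.ofReal_zero, zero_smul, sub_zero] at hR1 hR2
  have hRs : ∀ x y : E, ⟪R x, y⟫_ℂ = ⟪x, R y⟫_ℂ := by
    intro x y
    obtain ⟨hx, hx'⟩ := hR1 x
    obtain ⟨hy, hy'⟩ := hR1 y
    have := hsym ⟨R x, hx⟩ ⟨R y, hy⟩
    rw [hx', hy'] at this
    exact this.symm
  refine ⟨R, hR1, hR2, hRs, ?_⟩
  have hsa : IsSelfAdjoint R :=
    ContinuousLinearMap.isSelfAdjoint_iff_isSymmetric.mpr fun x y => hRs x y
  -- For self-adjoint `R` the norm equals the spectral radius, so it suffices to exclude real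
  -- spectral values `r` with |r| > τ. For these `r⁻¹ < 1 / τ` (trivially if `r < 0`), so `L - r⁻¹`
  -- is invertible.
  have hrad : spectralRadius ℂ R ≤ ENNReal.ofReal τ := by
    refine iSup₂_le fun z hz => ?_
    obtain ⟨r, rfl⟩ : ∃ r : ℝ, z = r := ⟨_, hsa.mem_spectrum_eq_re hz⟩
    rw [← ENNReal.ofReal_coe_nnreal, coe_nnnorm, Complex.norm_real]
    refine ENNReal.ofReal_le_ofReal ?_
    by_contra! hlt
    have hr0 : r ≠ 0 := by
      rintro h
      rw [h, norm_zero] at hlt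
      linarith
    have hrC : (r : ℂ) ≠ 0 := by exact_mod_cast hr0
    have hinv : r⁻¹ < 1 / τ := by
      rcases lt_or_gt_of_ne hr0 with h | h
      · exact (inv_lt_zero.mpr h).trans (by positivity)
      · rw [Real.norm_of_nonneg h.le] at hlt
        rw [one_div]
        exact inv_strictAnti₀ hτ hlt
    obtain ⟨R', h1, h2⟩ := hres _ hinv
    push_cast at h1 h2
    refine hz ?_
    -- From r - L⁻¹ = r (L - r⁻¹) L⁻¹ the inverse is r⁻¹ L (L - r⁻¹)⁻¹ = r⁻¹ + r⁻² R'.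
    let B : E →L[ℂ] E := (r : ℂ)⁻¹ • (1 : E →L[ℂ] E) + ((r : ℂ)⁻¹ * (r : ℂ)⁻¹) • R'
    refine ⟨⟨algebraMap ℂ (E →L[ℂ] E) r - R, B, ?_, ?_⟩, rfl⟩
    · ext y
      obtain ⟨hx, hx'⟩ := h1 y
      have hy : y = L ⟨R' y, hx⟩ - (r : ℂ)⁻¹ • R' y := hx'.symm
      have hRy : R y = R' y - (r : ℂ)⁻¹ • R (R' y) := by
        conv_lhs => rw [hy]
        rw [map_sub, hR2, map_smul]
      simp only [B, mul_apply_eq_comp, _root_.add_apply,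
        _root_.smul_apply, one_apply_eq_self,
        _root_.sub_apply, Algebra.algebraMap_eq_smul_one, map_add, map_smul, hRy]
      simp only [smul_sub, smul_smul]
      rw [inv_mul_cancel₀ hrC, mul_assoc, inv_mul_cancel₀ hrC]
      simp
    · ext y
      obtain ⟨hu, hu'⟩ := hR1 y
      have h3 := h2 ⟨R y, hu⟩
      simp only [hu'] at h3
      have h4 : (r : ℂ) • y - R y = (r : ℂ) • (y - (r : ℂ)⁻¹ • R y) := by
        rw [smul_sub, smul_smul, mul_inv_cancel₀ hrC, one_smul]
      simp only [B, mul_apply_eq_comp, _root_.add_apply,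
        _root_.smul_apply, one_apply_eq_self,
        _root_.sub_apply, Algebra.algebraMap_eq_smul_one]
      rw [h4, map_smul, h3, smul_smul, smul_smul, smul_sub, smul_smul, inv_mul_cancel₀ hrC,
        mul_assoc, inv_mul_cancel₀ hrC]
      simp
  rw [hsa.spectralRadius_eq_nnnorm] at hrad
  have := ENNReal.toReal_mono ENNReal.ofReal_ne_top hrad
  rwa [ENNReal.toReal_ofReal hτ.le, ENNReal.coe_toReal, coe_nnnorm] at this

/-- The kernel of a self-adjoint operator is closed. -/
theorem isClosed_of_eq_ker {J : E →ₗ.[ℂ] E} (hJ : IsSelfAdjoint J) {S : Submodule ℂ E}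
    (hker : ∀ φ : E, (∃ h : φ ∈ J.domain, J ⟨φ, h⟩ = 0) ↔ φ ∈ S) : IsClosed (S : Set E) := by
  -- The kernel of `J = J†` is the orthogonal complement of the range, an intersection of closed
  -- sets.
  have hset : (S : Set E) = ⋂ y : J.domain, {x | ⟪x, J y⟫_ℂ = 0} := by
    ext x
    simp only [SetLike.mem_coe, ← hker, Set.mem_iInter, Set.mem_ofPred_eq]
    have hadj : J.adjoint = J := hJ
    constructor
    · rintro ⟨h, h0⟩ y
      have := LinearPMap.adjoint_isFormalAdjoint hJ.dense_domain
      rw [hadj] at this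
      rw [← this ⟨x, h⟩ y, h0, inner_zero_left]
    · intro h
      have h0 : ∀ y : J.domain, ⟪(0 : E), (y : E)⟫_ℂ = ⟪x, J y⟫_ℂ := fun y => by
        rw [h y, inner_zero_left]
      have hm := LinearPMap.mem_adjoint_domain_of_exists (T := J) x ⟨0, h0⟩
      have ha := LinearPMap.adjoint_apply_eq hJ.dense_domain ⟨x, hm⟩ h0
      revert hm
      rw [hadj]
      exact fun hm ha => ⟨hm, ha⟩
  rw [hset]
  exact isClosed_iInter fun y => isClosed_eq (by fun_prop) continuous_const

/-- `K` is the reduced resolvent at `0` of `J`: the inverse of `J` on the orthogonal complement of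
its kernel `S`, extended by `0` to `S`; it is symmetric and bounded by `τ`. -/
structure IsReducedResolvent (J : E →ₗ.[ℂ] E) (S : Submodule ℂ E) [S.HasOrthogonalProjection]
    (τ : ℝ) (K : E →L[ℂ] E) : Prop where
  mem_orthogonal : ∀ y, K y ∈ Sᗮ
  apply_right : ∀ y, ∃ h : K y ∈ J.domain, J ⟨K y, h⟩ = y - S.starProjection y
  apply_left : ∀ x : J.domain, K (J x) = x - S.starProjection x
  symm : ∀ x y, ⟪K x, y⟫_ℂ = ⟪x, K y⟫_ℂ
  apply_ker : ∀ x ∈ S, K x = 0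
  norm_le : ‖K‖ ≤ τ

/-- Kernel and range of a self-adjoint operator are orthogonal. Physically this is the source of the
conservation laws: collisions drop out when the kinetic equation is paired with a summational
invariant. -/
theorem inner_map_eq_zero {J : E →ₗ.[ℂ] E} (hJ : IsSelfAdjoint J) {S : Submodule ℂ E}
    (hker : ∀ φ : E, (∃ h : φ ∈ J.domain, J ⟨φ, h⟩ = 0) ↔ φ ∈ S) {x : E} (hx : x ∈ S)
    (y : J.domain) : ⟪x, J y⟫_ℂ = 0 := by
  have hadj : J.adjoint = J := hJ
  obtain ⟨h, h0⟩ := (hker x).mpr hx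
  have := LinearPMap.adjoint_isFormalAdjoint hJ.dense_domain
  rw [hadj] at this
  rw [← this ⟨x, h⟩ y, h0, inner_zero_left]

/-- `J` splits along S ⊕ Sᗮ: its range lies in `Sᗮ`, and removing from a domain vector its component
in `S`, a kernel vector, stays in the domain. So inverting the part of `J` in `Sᗮ` and composing
with the projection gives `K`. -/
theorem exists_isReducedResolvent {J : E →ₗ.[ℂ] E} (hJ : IsSelfAdjoint J) {S : Submodule ℂ E}
    [S.HasOrthogonalProjection]
    (hker : ∀ φ : E, (∃ h : φ ∈ J.domain, J ⟨φ, h⟩ = 0) ↔ φ ∈ S) {τ : ℝ} (hτ : 0 < τ)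
    (hres : ∀ x : ℝ, x < 1 / τ → InResolventSet (partIn J Sᗮ) (x : ℂ)) :
    ∃ K : E →L[ℂ] E, IsReducedResolvent J S τ K := by
  have hadj : J.adjoint = J := hJ
  have hsym : ∀ x y : J.domain, ⟪J x, (y : E)⟫_ℂ = ⟪(x : E), J y⟫_ℂ := by
    have := LinearPMap.adjoint_isFormalAdjoint hJ.dense_domain
    rw [hadj] at this
    exact fun x y => this x y
  obtain ⟨R, h1, h2, h3, h4⟩ := exists_symmetric_inverse (partIn J Sᗮ)
    (fun x y => hsym ⟨_, x.2.choose⟩ ⟨_, y.2.choose⟩) hτ hres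
  have hPQ : ∀ y : E, ((Sᗮ.orthogonalProjectionOnto y : Sᗮ) : E) = y - S.starProjection y :=
    fun y => by rw [← Submodule.starProjection_apply, Submodule.starProjection_orthogonal_val]
  refine ⟨Sᗮ.subtypeL ∘L R ∘L Sᗮ.orthogonalProjectionOnto, ?_, ?_, ?_, ?_, ?_, ?_⟩
  · exact fun y => (R _).2
  · intro y
    obtain ⟨h, hy⟩ := h1 (Sᗮ.orthogonalProjectionOnto y)
    refine ⟨h.choose, ?_⟩
    rw [← hPQ]
    exact congrArg Subtype.val hy
  · intro x
    have hP : S.starProjection (x : E) ∈ S := Submodule.starProjection_apply_mem _ _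
    obtain ⟨hd, hz⟩ := (hker _).mpr hP
    have hQd : (Sᗮ.orthogonalProjectionOnto (x : E) : E) ∈ J.domain := by
      rw [hPQ]; exact J.domain.sub_mem x.2 hd
    have hQJ : J ⟨_, hQd⟩ = J x := by
      have : (⟨_, hQd⟩ : J.domain) = x - ⟨_, hd⟩ := Subtype.ext (hPQ x)
      rw [this, J.map_sub, hz, sub_zero]
    have hmem : J x ∈ Sᗮ := fun u hu => inner_map_eq_zero hJ hker hu x
    have hpd : Sᗮ.orthogonalProjectionOnto (x : E) ∈ (partIn J Sᗮ).domain :=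
      ⟨hQd, by rw [hQJ]; exact hmem⟩
    have h5 := h2 ⟨_, hpd⟩
    have h6 : partIn J Sᗮ ⟨_, hpd⟩ = Sᗮ.orthogonalProjectionOnto (J x) := by
      refine Subtype.ext ?_
      have h7 : (Sᗮ.orthogonalProjectionOnto (J x) : E) = J x := by
        rw [← Submodule.starProjection_apply, Submodule.starProjection_eq_self_iff]
        exact hmem
      rw [h7]
      exact hQJ
    rw [h6] at h5
    rw [← hPQ]
    exact congrArg Subtype.val h5
  · intro x y
    have := h3 (Sᗮ.orthogonalProjectionOnto x) (Sᗮ.orthogonalProjectionOnto y)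
    simp only [ContinuousLinearMap.comp_apply, Submodule.subtypeL_apply]
    rw [← Submodule.inner_orthogonalProjectionOnto_eq_of_mem_left,
      ← Submodule.inner_orthogonalProjectionOnto_eq_of_mem_right]
    exact this
  · intro x hx
    have : Sᗮ.orthogonalProjectionOnto x = 0 :=
      Submodule.orthogonalProjectionOnto_eq_zero_iff.mpr (Submodule.le_orthogonal_orthogonal S hx)
    simp [this]
  · refine ContinuousLinearMap.opNorm_le_bound _ hτ.le fun x => ?_
    calc ‖R (Sᗮ.orthogonalProjectionOnto x)‖ ≤ τ * ‖Sᗮ.orthogonalProjectionOnto x‖ :=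
          R.le_of_opNorm_le h4 _
      _ ≤ τ * ‖x‖ := by
          gcongr
          exact Submodule.norm_orthogonalProjectionOnto_apply_le _ _

/-- The fixed points of `x ↦ k (a + B x + ℓ(x) C x)` that branch off from `0` at `k = 0` depend
analytically on `k`. -/
theorem exists_analyticAt_fixedPoint (a : E) (B C : E →L[ℂ] E) (l : E →L[ℂ] ℂ) :
    ∃ ψ : ℂ → E, AnalyticAt ℂ ψ 0 ∧
      ∀ᶠ k in 𝓝 (0 : ℂ), ψ k = k • (a + B (ψ k) + l (ψ k) • C (ψ k)) := by
  let f : ℂ × E → E := fun u => u.2 - u.1 • (a + B u.2 + l u.2 • C u.2)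
  -- Here `⊤` is the analytic class, so the implicit function below is analytic. At k = 0, x = 0 the
  -- derivative of `f` in `x` is the identity.
  have hf : ContDiff ℂ ⊤ f := by fun_prop
  have hfd : HasFDerivAt f ((ContinuousLinearMap.snd ℂ ℂ E) -
      (ContinuousLinearMap.fst ℂ ℂ E).smulRight a) ((0 : ℂ), (0 : E)) := by
    have hg : DifferentiableAt ℂ (fun u : ℂ × E => a + B u.2 + l u.2 • C u.2) ((0 : ℂ), (0 : E)) := by
      fun_prop
    have h := hasFDerivAt_snd.fun_sub ((hasFDerivAt_fst (𝕜 := ℂ)).fun_smul hg.hasFDerivAt)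
    convert! h using 2
    simp
  have hinv : (fderiv ℂ f ((0 : ℂ), (0 : E)) ∘L .inr ℂ ℂ E).IsInvertible := by
    refine ⟨ContinuousLinearEquiv.refl ℂ E, ?_⟩
    rw [hfd.fderiv]
    ext x
    simp
  have hc : ContDiffAt ℂ ⊤ f ((0 : ℂ), (0 : E)) := hf.contDiffAt
  refine ⟨hc.implicitFunction (by simp) hinv, ?_, ?_⟩
  · have := hc.contDiffAt_implicitFunction (by simp) hinv
    exact this.analyticAt
  · filter_upwards [hc.eventually_apply_implicitFunction (by simp) hinv] with k hk
    have h0 : f ((0 : ℂ), (0 : E)) = 0 := by simp [f]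
    rw [h0] at hk
    exact sub_eq_zero.mp hk

end Abstract

namespace Equilibrium

variable (G : Equilibrium)

/-! ### The equilibrium measure -/

theorem continuous_energy : Continuous G.energy := by
  unfold energy; fun_prop

theorem energy_nonneg (p : Mom) : 0 ≤ G.energy p := Real.sqrt_nonneg _

theorem abs_le_energy (p : Mom) (i : Fin 3) : |p i| ≤ G.energy p := by
  refine Real.abs_le_sqrt ?_
  have := Finset.single_le_sum (f := fun i => p i ^ 2) (fun i _ => sq_nonneg (p i))
    (Finset.mem_univ i)
  nlinarith [sq_nonneg G.m]

theorem norm_le_energy (p : Mom) : ‖p‖ ≤ G.energy p :=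
  (pi_norm_le_iff_of_nonneg (G.energy_nonneg p)).mpr fun i => G.abs_le_energy p i

theorem energy_sq (p : Mom) : G.energy p ^ 2 = G.m ^ 2 + ∑ i, p i ^ 2 :=
  Real.sq_sqrt (by positivity)

theorem energy_sq_le (p : Mom) : G.energy p ^ 2 ≤ G.m ^ 2 + 3 * ‖p‖ ^ 2 := by
  have h : ∀ i, p i ^ 2 ≤ ‖p‖ ^ 2 := fun i => sq_le_sq' (abs_le.mp (norm_le_pi_norm p i)).1
    (abs_le.mp (norm_le_pi_norm p i)).2
  rw [energy_sq, Fin.sum_univ_three]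
  linarith [h 0, h 1, h 2]

theorem continuous_feq : Continuous G.feq := by
  have := G.continuous_energy
  unfold feq; fun_prop

theorem measurable_density :
    Measurable fun p => ENNReal.ofReal (G.feq p / (2 * Real.pi) ^ 3) :=
  (G.continuous_feq.measurable.div_const _).ennreal_ofReal

theorem density_pos (p : Mom) : 0 < G.feq p / (2 * Real.pi) ^ 3 :=
  div_pos (Real.exp_pos _) (by positivity)

theorem volume_absolutelyContinuous : (volume : Measure Mom) ≪ G.eqMeasure :=
  withDensity_absolutelyContinuous' G.measurable_density.aemeasurable
    (ae_of_all _ fun p => (ENNReal.ofReal_pos.mpr (G.density_pos p)).ne')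

/-- This allows identities between continuous functions of momentum that hold almost everywhere to
be evaluated at single points. -/
instance : G.eqMeasure.IsOpenPosMeasure := G.volume_absolutelyContinuous.isOpenPosMeasure

theorem feq_le (p : Mom) :
    G.feq p ≤ Real.exp ((G.μ + 1) / G.T) * (720 * G.T ^ 6) * ((1 + ‖p‖) ^ 6)⁻¹ := by
  have hT := G.T_pos
  have h1 : G.feq p ≤ Real.exp ((G.μ + 1) / G.T) * Real.exp (-((1 + ‖p‖) / G.T)) := by
    rw [feq, ← Real.exp_add]
    refine Real.exp_le_exp.mpr ?_
    rw [← neg_div, ← add_div]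
    gcongr
    linarith [G.norm_le_energy p]
  -- 720 = 6!. Decay of order 6 leaves order 4 against a quadratically growing integrand, which is
  -- integrable in dimension 3.
  have h2 := Real.pow_div_factorial_le_exp (x := (1 + ‖p‖) / G.T) (by positivity) 6
  have h3 : Real.exp (-((1 + ‖p‖) / G.T)) ≤ 720 * G.T ^ 6 * ((1 + ‖p‖) ^ 6)⁻¹ := by
    rw [Real.exp_neg]
    refine (inv_anti₀ (by positivity) h2).trans (le_of_eq ?_)
    have : (1 + ‖p‖) ≠ 0 := by positivity
    norm_num [Nat.factorial]
    field_simp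
  rw [mul_assoc]
  exact h1.trans (mul_le_mul_of_nonneg_left h3 (Real.exp_nonneg _))

theorem integrable_of_le {f : Mom → ℝ} (hf : AEStronglyMeasurable f volume) {C : ℝ}
    (hC : ∀ p, |f p| ≤ C * (1 + ‖p‖) ^ 2) : Integrable f G.eqMeasure := by
  rw [eqMeasure, integrable_withDensity_iff_integrable_smul' G.measurable_density
    (ae_of_all _ fun _ => ENNReal.ofReal_lt_top)]
  have hC0 : 0 ≤ C := by
    have := (abs_nonneg _).trans (hC 0)
    simpa using this
  have hdec : Integrable (fun p : Mom => (1 + ‖p‖) ^ (-(4 : ℝ))) volume :=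
    integrable_one_add_norm (by simp; norm_num)
  refine (hdec.const_mul (Real.exp ((G.μ + 1) / G.T) * (720 * G.T ^ 6) / (2 * Real.pi) ^ 3 *
    C)).mono' ?_ (ae_of_all _ fun p => ?_)
  · exact (G.measurable_density.ennreal_toReal.aestronglyMeasurable).smul hf
  · have hT := G.T_pos
    have h0 : 0 < 1 + ‖p‖ := by positivity
    rw [ENNReal.toReal_ofReal (G.density_pos p).le, norm_smul, Real.norm_of_nonneg
      (G.density_pos p).le, Real.norm_eq_abs]
    refine (mul_le_mul (div_le_div_of_nonneg_right (G.feq_le p) (by positivity)) (hC p)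
      (abs_nonneg _) (by positivity)).trans (le_of_eq ?_)
    rw [Real.rpow_neg h0.le, show (4 : ℝ) = ((4 : ℕ) : ℝ) by norm_num, Real.rpow_natCast]
    field_simp

theorem memLp_of_le {f : Mom → ℂ} (hf : AEStronglyMeasurable f volume) {C : ℝ}
    (hC : ∀ p, ‖f p‖ ≤ C * (1 + ‖p‖)) : MemLp f 2 G.eqMeasure := by
  have hac : G.eqMeasure ≪ volume := withDensity_absolutelyContinuous _ _
  rw [memLp_two_iff_integrable_sq_norm (hf.mono_ac hac)]
  refine G.integrable_of_le (C := C ^ 2) (hf.norm.pow 2) fun p => ?_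
  rw [abs_of_nonneg (by positivity), ← mul_pow]
  exact pow_le_pow_left₀ (norm_nonneg _) (hC p) 2

theorem enthalpyDensity_pos : 0 < G.enthalpyDensity := by
  have hint : Integrable G.energy G.eqMeasure := by
    refine G.integrable_of_le (C := G.m ^ 2 + 4) G.continuous_energy.aestronglyMeasurable
      fun p => ?_
    rw [abs_of_nonneg (G.energy_nonneg p)]
    nlinarith [G.energy_sq_le p, sq_nonneg (G.energy p - 1), norm_nonneg p, sq_nonneg G.m,
      mul_nonneg (sq_nonneg G.m) (norm_nonneg p), mul_nonneg (sq_nonneg G.m) (sq_nonneg ‖p‖)]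
  refine add_pos_of_pos_of_nonneg ?_ (integral_nonneg fun p =>
    div_nonneg (sq_nonneg _) (G.energy_nonneg p))
  rw [energyDensity, integral_pos_iff_support_of_nonneg G.energy_nonneg hint]
  -- The witness (1, 1, 1) avoids the origin, where the energy vanishes if `m = 0`.
  refine G.continuous_energy.isOpen_support.measure_pos _ ⟨fun _ => 1, ?_⟩
  have := G.abs_le_energy (fun _ => 1) 0
  rw [abs_one] at this
  exact (zero_lt_one.trans_le this).ne'

/-! ### Rotations -/

variable {Q : Matrix (Fin 3) (Fin 3) ℝ}

theorem energy_mulVec (hQ : Q ∈ Matrix.orthogonalGroup (Fin 3) ℝ) (p : Mom) :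
    G.energy (Q.mulVec p) = G.energy p := by
  have h : ∑ i, Q.mulVec p i ^ 2 = ∑ i, p i ^ 2 := by
    have h1 : ∀ q : Mom, ∑ i, q i ^ 2 = q ⬝ᵥ q := fun q => by
      simp only [dotProduct, sq]
    rw [h1, h1, Matrix.dotProduct_mulVec, Matrix.vecMul_mulVec,
      ← Matrix.dotProduct_mulVec, (Matrix.mem_orthogonalGroup_iff' (Fin 3) ℝ).mp hQ, Matrix.one_mulVec]
  rw [energy, h, energy]

/-- The density depends on the energy only, and |det Q| = 1. Improper matrices are included for the
sake of the inversion p ↦ -p. -/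
theorem measurePreserving_mulVec (hQ : Q ∈ Matrix.orthogonalGroup (Fin 3) ℝ) :
    MeasurePreserving Q.mulVec G.eqMeasure G.eqMeasure := by
  have hdet : |Q.det| = 1 := by
    have h := congrArg Matrix.det ((Matrix.mem_orthogonalGroup_iff (Fin 3) ℝ).mp hQ)
    rw [Matrix.det_mul, Matrix.det_transpose, Matrix.det_one] at h
    rcases mul_self_eq_one_iff.mp h with h | h <;> simp [h]
  have hmeas : Measurable Q.mulVec := (by fun_prop : Continuous Q.mulVec).measurable
  have hvol : MeasurePreserving Q.mulVec (volume : Measure Mom) volume := by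
    refine ⟨hmeas, ?_⟩
    have := Real.map_matrix_volume_pi_eq_smul_volume_pi (M := Q)
      (fun h => by rw [h, abs_zero] at hdet; exact zero_ne_one hdet)
    rw [abs_inv, hdet, inv_one, ENNReal.ofReal_one, one_smul] at this
    exact this
  refine ⟨hmeas, Measure.ext fun s hs => ?_⟩
  rw [Measure.map_apply hmeas hs, eqMeasure, withDensity_apply _ (hmeas hs),
    withDensity_apply _ hs, ← hvol.setLIntegral_comp_preimage hs G.measurable_density]
  simp only [feq, G.energy_mulVec hQ]

/-- The action `φ_p ↦ φ_{Qp}` of an orthogonal matrix on perturbations. -/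
def rot (Q : Matrix (Fin 3) (Fin 3) ℝ) (hQ : Q ∈ Matrix.orthogonalGroup (Fin 3) ℝ) :
    G.H →ₗᵢ[ℂ] G.H :=
  Lp.compMeasurePreservingₗᵢ ℂ Q.mulVec (G.measurePreserving_mulVec hQ)

theorem coeFn_rot (hQ : Q ∈ Matrix.orthogonalGroup (Fin 3) ℝ) (φ : G.H) :
    ∀ᵐ p ∂G.eqMeasure, (G.rot Q hQ φ : Mom → ℂ) p = (φ : Mom → ℂ) (Q.mulVec p) :=
  Lp.coeFn_compMeasurePreserving φ (G.measurePreserving_mulVec hQ)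

/-! ### Multiplication by the velocity -/

theorem measurable_v1 : Measurable G.v1 :=
  (measurable_pi_apply 0).div G.continuous_energy.measurable

/-- No particle outruns light; this is what makes `velocity` a contraction in the final bound. If `m
= 0`, the quotient at p = 0 takes the default value 0. -/
theorem abs_v1_le (p : Mom) : |G.v1 p| ≤ 1 := by
  rw [v1, abs_div, abs_of_nonneg (G.energy_nonneg p)]
  exact div_le_one_of_le₀ (G.abs_le_energy p 0) (G.energy_nonneg p)

theorem norm_v1_mul_le (p : Mom) (z : ℂ) : ‖(G.v1 p : ℂ) * z‖ ≤ 1 * ‖z‖ := by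
  rw [norm_mul, Complex.norm_real, Real.norm_eq_abs]
  exact mul_le_mul_of_nonneg_right (G.abs_v1_le p) (norm_nonneg _)

theorem memLp_v1_mul (φ : G.H) :
    MemLp (fun p => (G.v1 p : ℂ) * (φ : Mom → ℂ) p) 2 G.eqMeasure :=
  (Lp.memLp φ).of_le_mul
    ((Complex.measurable_ofReal.comp G.measurable_v1).aestronglyMeasurable.mul
      (Lp.aestronglyMeasurable φ)) (ae_of_all _ fun p => G.norm_v1_mul_le p _)

/-- Multiplication by the velocity `v¹`. -/
def velocity : G.H →L[ℂ] G.H :=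
  LinearMap.mkContinuous
    { toFun := fun φ => (G.memLp_v1_mul φ).toLp
      map_add' := fun φ ψ => by
        refine Lp.ext ?_
        filter_upwards [(G.memLp_v1_mul (φ + ψ)).coeFn_toLp, (G.memLp_v1_mul φ).coeFn_toLp,
          (G.memLp_v1_mul ψ).coeFn_toLp, Lp.coeFn_add φ ψ,
          Lp.coeFn_add (G.memLp_v1_mul φ).toLp (G.memLp_v1_mul ψ).toLp] with p h1 h2 h3 h4 h5
        rw [h1, h5, Pi.add_apply, h2, h3, h4, Pi.add_apply, mul_add]
      map_smul' := fun c φ => by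
        refine Lp.ext ?_
        filter_upwards [(G.memLp_v1_mul (c • φ)).coeFn_toLp, (G.memLp_v1_mul φ).coeFn_toLp,
          Lp.coeFn_smul c φ, Lp.coeFn_smul c (G.memLp_v1_mul φ).toLp] with p h1 h2 h3 h4
        rw [h1, RingHom.id_apply, h4, Pi.smul_apply, h2, h3, Pi.smul_apply, smul_eq_mul,
          smul_eq_mul, mul_left_comm] } 1 fun φ => by
      refine Lp.norm_le_mul_norm_of_ae_le_mul ?_
      filter_upwards [(G.memLp_v1_mul φ).coeFn_toLp] with p h
      exact (congrArg norm h).le.trans (G.norm_v1_mul_le p _)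

theorem coeFn_velocity (φ : G.H) :
    ∀ᵐ p ∂G.eqMeasure, (G.velocity φ : Mom → ℂ) p = (G.v1 p : ℂ) * (φ : Mom → ℂ) p :=
  (G.memLp_v1_mul φ).coeFn_toLp

theorem norm_velocity_apply_le (φ : G.H) : ‖G.velocity φ‖ ≤ ‖φ‖ := by
  have := G.velocity.le_of_opNorm_le (LinearMap.mkContinuous_norm_le _ zero_le_one _) φ
  rwa [one_mul] at this

theorem inner_velocity_left (φ ψ : G.H) : ⟪G.velocity φ, ψ⟫_ℂ = ⟪φ, G.velocity ψ⟫_ℂ := by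
  rw [L2.inner_def, L2.inner_def]
  refine integral_congr_ae ?_
  filter_upwards [G.coeFn_velocity φ, G.coeFn_velocity ψ] with p h1 h2
  simp only [h1, h2, RCLike.inner_apply, map_mul, Complex.conj_ofReal]
  ring

/-- If `Q` preserves the velocity `v¹` up to a factor `c`, then the action of `Q` and the velocity
operator commute up to this factor. -/
theorem velocity_rot (hQ : Q ∈ Matrix.orthogonalGroup (Fin 3) ℝ) {c : ℝ}
    (hc : ∀ p : Mom, Q.mulVec p 0 = c * p 0) (φ : G.H) :
    G.rot Q hQ (G.velocity φ) = (c : ℂ) • G.velocity (G.rot Q hQ φ) := by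
  refine Lp.ext ?_
  have hq := (G.measurePreserving_mulVec hQ).quasiMeasurePreserving.ae (G.coeFn_velocity φ)
  filter_upwards [hq, G.coeFn_rot hQ (G.velocity φ), G.coeFn_velocity (G.rot Q hQ φ),
    G.coeFn_rot hQ φ, Lp.coeFn_smul (c : ℂ) (G.velocity (G.rot Q hQ φ))] with p h1 h2 h3 h4 h5
  rw [h2, h1, h5, Pi.smul_apply, h3, h4, v1, v1, G.energy_mulVec hQ, hc]
  push_cast
  rw [smul_eq_mul]
  ring

/-! ### Momenta and shear modes -/

theorem memLp_coord (i : Fin 3) : MemLp (fun p : Mom => (p i : ℂ)) 2 G.eqMeasure := by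
  refine G.memLp_of_le (C := 1) (by fun_prop : Continuous _).aestronglyMeasurable fun p => ?_
  rw [Complex.norm_real, one_mul]
  linarith [norm_le_pi_norm p i]

/-- The component `p^{i+1}` of the momentum as a perturbation. -/
def coord (i : Fin 3) : G.H := (G.memLp_coord i).toLp

theorem coeFn_coord (i : Fin 3) :
    ∀ᵐ p ∂G.eqMeasure, (G.coord i : Mom → ℂ) p = (p i : ℂ) := (G.memLp_coord i).coeFn_toLp

theorem momentumDensity2_eq_inner (φ : G.H) : G.momentumDensity2 φ = ⟪G.coord 1, φ⟫_ℂ := by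
  rw [L2.inner_def]
  refine integral_congr_ae ?_
  filter_upwards [G.coeFn_coord 1] with p h
  simp only [h, RCLike.inner_apply, Complex.conj_ofReal]
  ring

theorem shearStress12_eq_inner (φ : G.H) :
    G.shearStress12 φ = ⟪G.velocity (G.coord 1), φ⟫_ℂ := by
  rw [L2.inner_def]
  refine integral_congr_ae ?_
  filter_upwards [G.coeFn_coord 1, G.coeFn_velocity (G.coord 1)] with p h h'
  simp only [h', h, RCLike.inner_apply, map_mul, Complex.conj_ofReal, v1]
  push_cast
  ring

/-- The shear modes `p² + i s p³`. -/
def shearMode (s : ℤ) : G.H := G.coord 1 + (Complex.I * s) • G.coord 2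

theorem coeFn_shearMode (s : ℤ) :
    ∀ᵐ p ∂G.eqMeasure, (G.shearMode s : Mom → ℂ) p = (p 1 : ℂ) + Complex.I * s * p 2 := by
  filter_upwards [G.coeFn_coord 1, G.coeFn_coord 2, Lp.coeFn_smul (Complex.I * s) (G.coord 2),
    Lp.coeFn_add (G.coord 1) ((Complex.I * s) • G.coord 2)] with p h1 h2 h3 h4
  rw [shearMode, h4, Pi.add_apply, h3, Pi.smul_apply, h1, h2, smul_eq_mul]

theorem coord_mem_hydro (i : Fin 3) : G.coord i ∈ G.hydro := by
  refine ⟨0, 0, Pi.single i 1, ?_⟩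
  filter_upwards [G.coeFn_coord i] with p h
  simp [h, Pi.single_apply]

theorem shearMode_mem_hydro (s : ℤ) : G.shearMode s ∈ G.hydro :=
  G.hydro.add_mem (G.coord_mem_hydro 1) (G.hydro.smul_mem _ (G.coord_mem_hydro 2))

theorem ae_eq_of_continuous {f g : Mom → ℂ} (hf : Continuous f) (hg : Continuous g)
    (h : ∀ᵐ p ∂G.eqMeasure, f p = g p) (p : Mom) : f p = g p :=
  congrFun ((hf.ae_eq_iff_eq G.eqMeasure hg).mp h) p

theorem shearMode_ne_zero (s : ℤ) : G.shearMode s ≠ 0 := by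
  intro h
  have h1 : ∀ᵐ p : Mom ∂G.eqMeasure, (p 1 : ℂ) + Complex.I * s * p 2 = 0 := by
    filter_upwards [G.coeFn_shearMode s, Lp.coeFn_zero ℂ 2 G.eqMeasure] with p h1 h2
    rw [← h1, h, h2, Pi.zero_apply]
  have := G.ae_eq_of_continuous (by fun_prop) continuous_const h1 ![0, 1, 0]
  simp at this

theorem rot_shearMode (hQ : Q ∈ Matrix.orthogonalGroup (Fin 3) ℝ) {s t : ℤ} {c : ℂ}
    (h : ∀ p : Mom, (Q.mulVec p 1 : ℂ) + Complex.I * s * Q.mulVec p 2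
      = c * ((p 1 : ℂ) + Complex.I * t * p 2)) :
    G.rot Q hQ (G.shearMode s) = c • G.shearMode t := by
  refine Lp.ext ?_
  have hq := (G.measurePreserving_mulVec hQ).quasiMeasurePreserving.ae (G.coeFn_shearMode s)
  filter_upwards [hq, G.coeFn_rot hQ (G.shearMode s), G.coeFn_shearMode t,
    Lp.coeFn_smul c (G.shearMode t)] with p h1 h2 h3 h4
  rw [h2, h1, h4, Pi.smul_apply, h3, h, smul_eq_mul]

/-! ### Spin around axis 1 -/

theorem rotAxis1_mem (θ : ℝ) : rotAxis1 θ ∈ Matrix.specialOrthogonalGroup (Fin 3) ℝ := by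
  rw [Matrix.mem_specialOrthogonalGroup_iff, Matrix.mem_orthogonalGroup_iff]
  have h := Real.sin_sq_add_cos_sq θ
  constructor
  · ext i j
    fin_cases i <;> fin_cases j <;>
      simp [rotAxis1, Matrix.mul_apply, Fin.sum_univ_three] <;> linarith
  · simp [rotAxis1, Matrix.det_fin_three]
    linarith

theorem rotAxis1_mulVec (θ : ℝ) (p : Mom) : (rotAxis1 θ).mulVec p =
    ![p 0, Real.cos θ * p 1 - Real.sin θ * p 2, Real.sin θ * p 1 + Real.cos θ * p 2] := by
  ext i
  fin_cases i <;> simp [rotAxis1, Matrix.mulVec, dotProduct, Fin.sum_univ_three]; ring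

/-- The perturbations of spin `s` around axis 1. -/
def spinSpace (s : ℤ) : Submodule ℂ G.H where
  carrier := {φ | ∀ θ : ℝ, G.rot (rotAxis1 θ) (rotAxis1_mem θ).1 φ
    = Complex.exp (Complex.I * s * θ) • φ}
  add_mem' := fun {φ ψ} hφ hψ θ => by rw [map_add, hφ, hψ, smul_add]
  zero_mem' := fun θ => by rw [map_zero, smul_zero]
  smul_mem' := fun c φ hφ θ => by rw [map_smul, hφ, smul_comm]

theorem mem_spinSpace_iff {s : ℤ} {φ : G.H} : φ ∈ G.spinSpace s ↔ ∀ θ : ℝ,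
    ∀ᵐ p ∂G.eqMeasure, (φ : Mom → ℂ) ((rotAxis1 θ).mulVec p)
      = Complex.exp (Complex.I * s * θ) * (φ : Mom → ℂ) p := by
  refine forall_congr' fun θ => ⟨fun h => ?_, fun h => Lp.ext ?_⟩
  · filter_upwards [G.coeFn_rot (rotAxis1_mem θ).1 φ,
      Lp.coeFn_smul (Complex.exp (Complex.I * s * θ)) φ] with p h1 h2
    rw [← h1, h, h2, Pi.smul_apply, smul_eq_mul]
  · filter_upwards [h, G.coeFn_rot (rotAxis1_mem θ).1 φ,
      Lp.coeFn_smul (Complex.exp (Complex.I * s * θ)) φ] with p h0 h1 h2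
    rw [h1, h2, h0, Pi.smul_apply, smul_eq_mul]

theorem isClosed_spinSpace (s : ℤ) : IsClosed (G.spinSpace s : Set G.H) := by
  have : (G.spinSpace s : Set G.H) = ⋂ θ : ℝ, {φ | G.rot (rotAxis1 θ) (rotAxis1_mem θ).1 φ
      = Complex.exp (Complex.I * s * θ) • φ} := by
    ext φ
    simp only [Set.mem_iInter]
    rfl
  rw [this]
  exact isClosed_iInter fun θ => isClosed_eq (G.rot _ _).continuous (by fun_prop)

instance (s : ℤ) : CompleteSpace (G.spinSpace s) :=
  (G.isClosed_spinSpace s).completeSpace_coe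

theorem velocity_mem_spinSpace {s : ℤ} {φ : G.H} (hφ : φ ∈ G.spinSpace s) :
    G.velocity φ ∈ G.spinSpace s := fun θ => by
  have := G.velocity_rot (rotAxis1_mem θ).1 (c := 1) (fun p => by simp [rotAxis1_mulVec]) φ
  rw [this, Complex.ofReal_one, one_smul, hφ θ, map_smul]

variable {s : ℤ}

theorem exp_I_mul_spin (hs : s = 1 ∨ s = -1) (θ : ℝ) :
    Complex.exp (Complex.I * s * θ) = Real.cos θ + Complex.I * s * Real.sin θ := by
  rw [mul_right_comm, mul_comm Complex.I]
  rcases hs with rfl | rfl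
  · rw [Int.cast_one, mul_one, Complex.exp_mul_I]
    push_cast
    ring
  · rw [Int.cast_neg, Int.cast_one, mul_neg_one, ← neg_mul, Complex.exp_mul_I, Complex.cos_neg,
      Complex.sin_neg]
    push_cast
    ring

theorem shearMode_mem_spinSpace (hs : s = 1 ∨ s = -1) : G.shearMode s ∈ G.spinSpace s :=
  fun θ => G.rot_shearMode (rotAxis1_mem θ).1 fun p => by
    have hI : (Complex.I * s) ^ 2 = -1 := by rcases hs with rfl | rfl <;> simp
    rw [rotAxis1_mulVec, exp_I_mul_spin hs]
    simp
    linear_combination (-(Complex.sin θ * p 2)) * hI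

/-- A quarter turn is isometric, yet multiplies the inner product by (i s)² = -1. -/
theorem inner_eq_zero_of_mem_spinSpace (hs : s = 1 ∨ s = -1) {φ ψ : G.H}
    (hφ : φ ∈ G.spinSpace (-s)) (hψ : ψ ∈ G.spinSpace s) : ⟪φ, ψ⟫_ℂ = 0 := by
  have hI : (Complex.I * s) ^ 2 = -1 := by rcases hs with rfl | rfl <;> simp
  have h := (G.rot (rotAxis1 (Real.pi / 2)) (rotAxis1_mem _).1).inner_map_map φ ψ
  rw [hφ, hψ, inner_smul_left, inner_smul_right, exp_I_mul_spin hs,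
    exp_I_mul_spin (s := -s) (by omega)] at h
  simp at h
  refine self_eq_neg.mp ?_
  linear_combination hI * ⟪φ, ψ⟫_ℂ - h

/-- The hydrodynamic modes of spin `±1` are the multiples of the shear mode. -/
theorem exists_eq_smul_shearMode (hs : s = 1 ∨ s = -1) {φ : G.H} (hφ : φ ∈ G.hydro)
    (hsp : φ ∈ G.spinSpace s) : ∃ c : ℂ, φ = c • G.shearMode s := by
  obtain ⟨a, b₀, b, h⟩ := hφ
  have hrot : ∀ (θ : ℝ) (p : Mom),
      a + b₀ * (G.energy p : ℂ) + ∑ i, b i * ((rotAxis1 θ).mulVec p i : ℂ)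
        = Complex.exp (Complex.I * s * θ) *
          (a + b₀ * (G.energy p : ℂ) + ∑ i, b i * (p i : ℂ)) := by
    intro θ
    have hE := G.continuous_energy
    refine G.ae_eq_of_continuous (by fun_prop) (by fun_prop) ?_
    have hq := (G.measurePreserving_mulVec (rotAxis1_mem θ).1).quasiMeasurePreserving.ae h
    filter_upwards [hq, h, G.mem_spinSpace_iff.mp hsp θ] with p h1 h2 h3
    rw [← h2, ← h3, h1, G.energy_mulVec (rotAxis1_mem θ).1]
  have hexp : Complex.exp (Complex.I * s * (Real.pi : ℝ)) = -1 := by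
    simp [exp_I_mul_spin hs]
  have hexp2 : Complex.exp (Complex.I * s * ((Real.pi / 2 : ℝ) : ℂ)) = Complex.I * s := by
    rw [exp_I_mul_spin hs]
    simp
  -- The half turn acts as -1 on spin ±1, but fixes 1, p⁰ and p¹.
  have h0 : ∀ p : Mom, a + b₀ * (G.energy p : ℂ) + b 0 * p 0 = 0 := by
    intro p
    have h1 := hrot Real.pi p
    rw [hexp, rotAxis1_mulVec] at h1
    simp [Fin.sum_univ_three] at h1
    linear_combination h1 / 2
  -- The quarter turn takes the unit vector of axis 2 to that of axis 3.
  have h2 : b 2 = Complex.I * s * b 1 := by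
    have h1 := hrot (Real.pi / 2) ![0, 1, 0]
    have h3 := h0 ![0, 1, 0]
    rw [hexp2, rotAxis1_mulVec] at h1
    simp [Fin.sum_univ_three] at h1 h3
    linear_combination h1 + (Complex.I * s - 1) * h3
  refine ⟨b 1, Lp.ext ?_⟩
  filter_upwards [h, G.coeFn_shearMode s, Lp.coeFn_smul (b 1) (G.shearMode s)] with p h3 h4 h5
  rw [h3, h5, Pi.smul_apply, h4, Fin.sum_univ_three, h2, smul_eq_mul]
  linear_combination h0 p

/-- p² is the mean of the two shear modes, and the one of opposite spin is orthogonal to φ. -/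
theorem inner_coord_one (hs : s = 1 ∨ s = -1) {φ : G.H} (hφ : φ ∈ G.spinSpace s) :
    ⟪G.coord 1, φ⟫_ℂ = ⟪G.shearMode s, φ⟫_ℂ / 2 := by
  have h1 : G.coord 1 + G.coord 1 = G.shearMode s + G.shearMode (-s) := by
    simp only [shearMode, Int.cast_neg, mul_neg, neg_smul]
    abel
  have hs' : -s = 1 ∨ -s = -1 := by omega
  have h2 := congrArg (fun x => ⟪x, φ⟫_ℂ) h1
  simp only [inner_add_left, G.inner_eq_zero_of_mem_spinSpace hs
    (G.shearMode_mem_spinSpace hs') hφ] at h2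
  linear_combination h2 / 2

/-- Parity: under p ↦ -p the shear mode is odd and v¹χ is even. Hence the frequency has no term
linear in k. Only the measure, not `J`, needs to be invariant under inversion. -/
theorem inner_shearMode_velocity_self (s : ℤ) :
    ⟪G.shearMode s, G.velocity (G.shearMode s)⟫_ℂ = 0 := by
  have hQ : (-1 : Matrix (Fin 3) (Fin 3) ℝ) ∈ Matrix.orthogonalGroup (Fin 3) ℝ := by
    rw [Matrix.mem_orthogonalGroup_iff]
    simp
  have h1 : G.rot (-1) hQ (G.shearMode s) = (-1 : ℂ) • G.shearMode s :=
    G.rot_shearMode hQ fun p => by simp [Matrix.neg_mulVec]; ring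
  have h2 := G.velocity_rot hQ (c := -1) (fun p => by simp [Matrix.neg_mulVec]) (G.shearMode s)
  have h := (G.rot (-1) hQ).inner_map_map (G.shearMode s) (G.velocity (G.shearMode s))
  rw [h2, h1] at h
  simp only [map_smul, inner_smul_left, inner_smul_right] at h
  simp at h
  exact self_eq_neg.mp h.symm

/-! ### The collision operator and rotations -/

section Collision

variable {G} {J : G.H →ₗ.[ℂ] G.H} (hJ : G.IsCollisionOperator J)
  {Q : Matrix (Fin 3) (Fin 3) ℝ}

include hJ

theorem IsCollisionOperator.hasOrthogonalProjection : G.hydro.HasOrthogonalProjection :=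
  haveI := (isClosed_of_eq_ker hJ.selfAdjoint hJ.ker_iff).completeSpace_coe
  inferInstance

theorem IsCollisionOperator.apply_rot (hQ : Q ∈ Matrix.specialOrthogonalGroup (Fin 3) ℝ)
    (φ : J.domain) : ∃ h : G.rot Q hQ.1 φ ∈ J.domain, J ⟨_, h⟩ = G.rot Q hQ.1 (J φ) := by
  obtain ⟨h, h'⟩ := hJ.rotation Q hQ φ (G.rot Q hQ.1 φ) (G.coeFn_rot hQ.1 φ)
  refine ⟨h, Lp.ext ?_⟩
  filter_upwards [h', G.coeFn_rot hQ.1 (J φ)] with p h1 h2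
  rw [h1, h2]

theorem IsCollisionOperator.rot_mem_hydro (hQ : Q ∈ Matrix.specialOrthogonalGroup (Fin 3) ℝ)
    {φ : G.H} (hφ : φ ∈ G.hydro) : G.rot Q hQ.1 φ ∈ G.hydro := by
  obtain ⟨h, h0⟩ := (hJ.ker_iff φ).mpr hφ
  obtain ⟨h', h1⟩ := hJ.apply_rot hQ ⟨φ, h⟩
  exact (hJ.ker_iff _).mp ⟨h', by rw [h1, h0, map_zero]⟩

theorem HasGap.exists_isReducedResolvent [G.hydro.HasOrthogonalProjection] {τg : ℝ}
    (hgap : G.HasGap J τg) : ∃ K : G.H →L[ℂ] G.H, IsReducedResolvent J G.hydro τg K := by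
  refine KineticGas.exists_isReducedResolvent hJ.selfAdjoint hJ.ker_iff hgap.1 fun x hx => ?_
  by_contra h
  exact absurd (hgap.2.1 h) (not_le.mpr hx)

variable [G.hydro.HasOrthogonalProjection] {K : G.H →L[ℂ] G.H} {τ : ℝ}
  (hK : IsReducedResolvent J G.hydro τ K)

include hK

/-- A non-hydrodynamic φ equals J(Kφ), so its rotation is again in the range of `J`, hence
orthogonal to the kernel. -/
theorem rot_mem_nonHydro (hQ : Q ∈ Matrix.specialOrthogonalGroup (Fin 3) ℝ) {φ : G.H}
    (hφ : φ ∈ G.nonHydro) : G.rot Q hQ.1 φ ∈ G.nonHydro := by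
  obtain ⟨h, h0⟩ := hK.apply_right φ
  obtain ⟨h', h1⟩ := hJ.apply_rot hQ ⟨_, h⟩
  rw [h0, (Submodule.starProjection_apply_eq_zero_iff G.hydro).mpr hφ, sub_zero] at h1
  rw [← h1]
  exact fun u hu => inner_map_eq_zero hJ.selfAdjoint hJ.ker_iff hu _

theorem starProjection_rot (hQ : Q ∈ Matrix.specialOrthogonalGroup (Fin 3) ℝ) (φ : G.H) :
    G.hydro.starProjection (G.rot Q hQ.1 φ) = G.rot Q hQ.1 (G.hydro.starProjection φ) := by
  refine Submodule.eq_starProjection_of_mem_orthogonal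
    (hJ.rot_mem_hydro hQ (Submodule.starProjection_apply_mem _ _)) ?_
  rw [← map_sub]
  exact rot_mem_nonHydro hJ hK hQ (Submodule.sub_starProjection_mem_orthogonal _)

/-- Rotate J(Kφ) = φ - Pφ, with P the hydrodynamic projection, and apply `K` on the left; the
projected terms vanish. -/
theorem reducedResolvent_rot (hQ : Q ∈ Matrix.specialOrthogonalGroup (Fin 3) ℝ) (φ : G.H) :
    K (G.rot Q hQ.1 φ) = G.rot Q hQ.1 (K φ) := by
  obtain ⟨h, h0⟩ := hK.apply_right φ
  obtain ⟨h', h1⟩ := hJ.apply_rot hQ ⟨_, h⟩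
  have h2 := hK.apply_left ⟨_, h'⟩
  rw [h1, h0, map_sub, map_sub, ← starProjection_rot hJ hK hQ,
    hK.apply_ker _ (Submodule.starProjection_apply_mem _ _), sub_zero,
    (Submodule.starProjection_apply_eq_zero_iff G.hydro).mpr
      (rot_mem_nonHydro hJ hK hQ (hK.mem_orthogonal φ)), sub_zero] at h2
  exact h2

theorem reducedResolvent_mem_spinSpace {φ : G.H} (hφ : φ ∈ G.spinSpace s) :
    K φ ∈ G.spinSpace s := fun θ => by
  rw [← reducedResolvent_rot hJ hK (rotAxis1_mem θ), hφ θ, map_smul]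

/-- The projection commutes with rotations, so it preserves the spin; within spin `s` the
hydrodynamic space is the line through χ. -/
theorem starProjection_eq_smul_shearMode (hs : s = 1 ∨ s = -1) {φ : G.H}
    (hφ : φ ∈ G.spinSpace s) : G.hydro.starProjection φ =
      (⟪G.shearMode s, φ⟫_ℂ / ⟪G.shearMode s, G.shearMode s⟫_ℂ) • G.shearMode s := by
  obtain ⟨c, hc⟩ := G.exists_eq_smul_shearMode hs
    (Submodule.starProjection_apply_mem G.hydro φ) fun θ => by
      rw [← starProjection_rot hJ hK (rotAxis1_mem θ), hφ θ, map_smul]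
  have h1 : ⟪G.shearMode s, φ⟫_ℂ = ⟪G.shearMode s, G.hydro.starProjection φ⟫_ℂ := by
    rw [← sub_eq_zero, ← inner_sub_right]
    exact Submodule.sub_starProjection_mem_orthogonal φ _ (G.shearMode_mem_hydro s)
  rw [h1, hc, inner_smul_right, mul_div_cancel_right₀]
  exact inner_self_ne_zero.mpr (G.shearMode_ne_zero s)

end Collision

end Equilibrium

namespace Equilibrium

variable {G : Equilibrium} {s : ℤ}

/-! ### The damping rate of shear waves -/

/-- The coefficient `(v¹ χ, K v¹ χ) / (χ, χ)` of `-i k²` in the frequency of the shear wave that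
branches off from the shear mode `χ` of polarisation `s`. -/
def damping (K : G.H →L[ℂ] G.H) (s : ℤ) : ℂ :=
  ⟪G.velocity (G.shearMode s), K (G.velocity (G.shearMode s))⟫_ℂ /
    ⟪G.shearMode s, G.shearMode s⟫_ℂ

section Collision

variable {J : G.H →ₗ.[ℂ] G.H} (hJ : G.IsCollisionOperator J)
  [G.hydro.HasOrthogonalProjection] {K : G.H →L[ℂ] G.H} {τ : ℝ}
  (hK : IsReducedResolvent J G.hydro τ K)

include hK

theorem damping_re (s : ℤ) : ((damping K s).re : ℂ) = damping K s := by
  refine Complex.conj_eq_iff_re.mp ?_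
  rw [damping, map_div₀, inner_conj_symm, inner_conj_symm, hK.symm]

theorem damping_re_le (hτ : 0 < τ) (s : ℤ) : (damping K s).re ≤ τ := by
  refine (Complex.re_le_norm _).trans ?_
  have hn : 0 < ‖G.shearMode s‖ := norm_pos_iff.mpr (G.shearMode_ne_zero s)
  have hv := G.norm_velocity_apply_le (G.shearMode s)
  rw [damping, norm_div, inner_self_eq_norm_sq_to_K, div_le_iff₀ (by simpa using pow_pos hn 2)]
  calc ‖⟪G.velocity (G.shearMode s), K (G.velocity (G.shearMode s))⟫_ℂ‖
      ≤ ‖G.velocity (G.shearMode s)‖ * ‖K (G.velocity (G.shearMode s))‖ := norm_inner_le_norm _ _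
    _ ≤ ‖G.shearMode s‖ * (τ * ‖G.shearMode s‖) := by
        refine mul_le_mul hv ?_ (norm_nonneg _) (norm_nonneg _)
        exact (K.le_of_opNorm_le hK.norm_le _).trans (by gcongr)
    _ = _ := by simp; ring

include hJ

/-- The half turn around axis 2 exchanges the two polarisations and reverses v¹; being a proper
rotation, it commutes with `K`. So one η serves both polarisations. -/
theorem damping_neg_one : damping K (-1) = damping K 1 := by
  have hQ : !![-1, 0, 0; 0, 1, 0; 0, 0, -1] ∈ Matrix.specialOrthogonalGroup (Fin 3) ℝ := by
    rw [Matrix.mem_specialOrthogonalGroup_iff, Matrix.mem_orthogonalGroup_iff]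
    constructor
    · ext i j
      fin_cases i <;> fin_cases j <;> simp [Matrix.mul_apply, Fin.sum_univ_three]
    · simp [Matrix.det_fin_three]
  have hχ : G.rot _ hQ.1 (G.shearMode 1) = G.shearMode (-1) := by
    rw [G.rot_shearMode (t := -1) (c := 1) hQ.1, one_smul]
    intro p
    simp [Matrix.mulVec, dotProduct, Fin.sum_univ_three]
  have hV : G.rot _ hQ.1 (G.velocity (G.shearMode 1)) = -G.velocity (G.shearMode (-1)) := by
    rw [G.velocity_rot hQ.1 (c := -1), hχ]
    · simp
    · intro p
      simp [Matrix.mulVec, dotProduct, Fin.sum_univ_three]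
  have h1 := (G.rot _ hQ.1).inner_map_map (G.velocity (G.shearMode 1))
    (K (G.velocity (G.shearMode 1)))
  have h2 := (G.rot _ hQ.1).inner_map_map (G.shearMode 1) (G.shearMode 1)
  rw [← reducedResolvent_rot hJ hK hQ, hV, map_neg, inner_neg_neg] at h1
  rw [hχ] at h2
  rw [damping, damping, h1, h2]

theorem damping_eq (hs : s = 1 ∨ s = -1) : damping K s = damping K 1 := by
  rcases hs with rfl | rfl
  · rfl
  · exact damping_neg_one hJ hK

/-! ### Asymptotics of shear waves -/

omit hJ hK [G.hydro.HasOrthogonalProjection] in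
theorem IsShearWave.kinetic_eq_vector {ω : ℂ → ℂ} {φ : ℂ → G.H} (hw : G.IsShearWave J s ω φ) :
    ∀ᶠ k in 𝓝 (0 : ℂ), ∃ h : φ k ∈ J.domain,
      J ⟨φ k, h⟩ = (Complex.I * ω k) • φ k - (Complex.I * k) • G.velocity (φ k) := by
  filter_upwards [hw.kinetic_eq] with k ⟨h, h1⟩
  refine ⟨h, Lp.ext ?_⟩
  filter_upwards [h1, Lp.coeFn_sub ((Complex.I * ω k) • φ k) ((Complex.I * k) • G.velocity (φ k)),
    Lp.coeFn_smul (Complex.I * ω k) (φ k), Lp.coeFn_smul (Complex.I * k) (G.velocity (φ k)),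
    G.coeFn_velocity (φ k)] with p h1 h2 h3 h4 h5
  rw [h2, Pi.sub_apply, h3, h4, Pi.smul_apply, Pi.smul_apply, h5, smul_eq_mul, smul_eq_mul, ← h1]
  ring

/-- At k = 0 the state lies in the kernel and has spin `s`, so it is a multiple of χ, and it is
nonzero by assumption. -/
theorem IsShearWave.inner_shearMode_ne_zero {ω : ℂ → ℂ} {φ : ℂ → G.H}
    (hs : s = 1 ∨ s = -1) (hw : G.IsShearWave J s ω φ) : ⟪G.shearMode s, φ 0⟫_ℂ ≠ 0 := by
  have hsp : φ 0 ∈ G.spinSpace s := G.mem_spinSpace_iff.mpr hw.spin.self_of_nhds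
  obtain ⟨h, h0⟩ := (hw.kinetic_eq_vector).self_of_nhds
  rw [hw.freq_zero, mul_zero, zero_smul, zero_smul, sub_zero] at h0
  have hP := Submodule.starProjection_eq_self_iff.mpr ((hJ.ker_iff _).mp ⟨h, h0⟩)
  rw [starProjection_eq_smul_shearMode hJ hK hs hsp] at hP
  intro hz
  rw [hz, zero_div, zero_smul] at hP
  exact hw.state_ne_zero hP.symm

omit hK [G.hydro.HasOrthogonalProjection] in
/-- Conservation of the transverse momentum. -/
theorem IsShearWave.momentum_conservation {ω : ℂ → ℂ} {φ : ℂ → G.H}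
    (hw : G.IsShearWave J s ω φ) : ∀ᶠ k in 𝓝 (0 : ℂ),
      k * ⟪G.shearMode s, G.velocity (φ k)⟫_ℂ = ω k * ⟪G.shearMode s, φ k⟫_ℂ := by
  filter_upwards [hw.kinetic_eq_vector] with k ⟨h, h1⟩
  have h2 := inner_map_eq_zero hJ.selfAdjoint hJ.ker_iff (G.shearMode_mem_hydro s) ⟨φ k, h⟩
  rw [h1, inner_sub_right, inner_smul_right, inner_smul_right] at h2
  refine mul_left_cancel₀ Complex.I_ne_zero ?_
  linear_combination -h2

/-- Fick's law: the flux of transverse momentum of a shear wave to first order in the wave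
number. -/
theorem IsShearWave.flux_isBigO {ω : ℂ → ℂ} {φ : ℂ → G.H} (hs : s = 1 ∨ s = -1)
    (hw : G.IsShearWave J s ω φ) :
    (fun k => ⟪G.shearMode s, G.velocity (φ k)⟫_ℂ +
      Complex.I * k * damping K s * ⟪G.shearMode s, φ k⟫_ℂ) =O[𝓝 0] fun k : ℂ => k ^ 2 := by
  set χ := G.shearMode s
  set ψ : ℂ → G.H := fun k => φ k - G.hydro.starProjection (φ k) with hψ
  have hKψ : ∀ k, K (φ k) = K (ψ k) := fun k => by
    rw [hψ, map_sub, hK.apply_ker _ (Submodule.starProjection_apply_mem _ _), sub_zero]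
  -- `K` applied to the kinetic equation recovers the non-hydrodynamic part and shows it to be O(k).
  have hψ_eq : ∀ᶠ k in 𝓝 (0 : ℂ),
      ψ k = (Complex.I * ω k) • K (φ k) - (Complex.I * k) • K (G.velocity (φ k)) := by
    filter_upwards [hw.kinetic_eq_vector] with k ⟨h, h1⟩
    rw [hψ, ← map_smul, ← map_smul, ← map_sub, ← h1]
    exact (hK.apply_left ⟨φ k, h⟩).symm
  have hω : ω =O[𝓝 0] fun k : ℂ => k := by
    simpa [hw.freq_zero] using hw.analytic_freq.differentiableAt.isBigO_sub
  have hI : (fun k : ℂ => Complex.I * k) =O[𝓝 0] fun k : ℂ => k :=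
    (Asymptotics.isBigO_refl _ _).const_mul_left _
  have hφ := hw.analytic_state.continuousAt
  have hψO : ψ =O[𝓝 0] fun k : ℂ => k := by
    refine Asymptotics.IsBigO.congr' ?_ (hψ_eq.mono fun _ h => h.symm) EventuallyEq.rfl
    have h1 : (fun k => K (φ k)) =O[𝓝 0] fun _ => (1 : ℂ) :=
      (K.continuous.continuousAt.comp hφ).isBigO_one ℂ
    have h2 : (fun k => K (G.velocity (φ k))) =O[𝓝 0] fun _ => (1 : ℂ) :=
      ((K.comp G.velocity).continuous.continuousAt.comp hφ).isBigO_one ℂ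
    simpa using ((hω.const_mul_left Complex.I).smul h1).sub (hI.smul h2)
  -- The contribution of ψ to the right-hand side carries a second factor k, since ω = O(k). The
  -- term in ω acting on χ is absent because Kχ = 0.
  have hrem : (fun k => Complex.I * ω k * innerSL ℂ (G.velocity χ) (K (ψ k)) -
      Complex.I * k * innerSL ℂ (G.velocity χ) (K (G.velocity (ψ k)))) =O[𝓝 0]
        fun k : ℂ => k ^ 2 := by
    have h1 := ((innerSL ℂ (G.velocity χ)).comp K).isBigO_comp ψ (𝓝 0)
    have h2 := (((innerSL ℂ (G.velocity χ)).comp K).comp G.velocity).isBigO_comp ψ (𝓝 0)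
    exact (((hω.const_mul_left Complex.I).mul (h1.trans hψO)).sub
      (hI.mul (h2.trans hψO))).congr_right fun k => (sq k).symm
  refine hrem.congr' ?_ EventuallyEq.rfl
  filter_upwards [hψ_eq, hw.spin] with k h1 h2
  have hφk : φ k = (⟪χ, φ k⟫_ℂ / ⟪χ, χ⟫_ℂ) • χ + ψ k := by
    rw [← starProjection_eq_smul_shearMode hJ hK hs (G.mem_spinSpace_iff.mpr h2), hψ]
    exact (add_sub_cancel _ _).symm
  set c := ⟪χ, φ k⟫_ℂ / ⟪χ, χ⟫_ℂ with hc
  have h3 : ⟪χ, G.velocity (φ k)⟫_ℂ = ⟪G.velocity χ, ψ k⟫_ℂ := by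
    rw [hφk, map_add, map_smul, inner_add_right, inner_smul_right,
      G.inner_shearMode_velocity_self s, mul_zero, zero_add, inner_velocity_left]
  have h4 : ⟪G.velocity χ, K (G.velocity (φ k))⟫_ℂ =
      c * ⟪G.velocity χ, K (G.velocity χ)⟫_ℂ + ⟪G.velocity χ, K (G.velocity (ψ k))⟫_ℂ := by
    conv_lhs => rw [hφk]
    simp only [map_add, map_smul, inner_add_right, inner_smul_right]
  have h5 : damping K s * ⟪χ, φ k⟫_ℂ = c * ⟪G.velocity χ, K (G.velocity χ)⟫_ℂ := by
    rw [damping, hc]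
    ring
  have h6 := congrArg (fun x => ⟪G.velocity χ, x⟫_ℂ) h1
  simp only [inner_sub_right, inner_smul_right, h4, hKψ] at h6
  rw [h3, h6, mul_assoc _ (damping K s), h5]
  simp only [innerSL_apply_apply]
  ring

/-- The stress law is half of the flux law, the factor 1/2 occurring on both sides by
`inner_coord_one`. The dispersion relation follows on multiplying the flux law by k and dividing by
(χ, φ), which is nonzero near k = 0. -/
theorem isShearViscosity_damping :
    G.IsShearViscosity J (G.enthalpyDensity * (damping K 1).re) := by
  intro s ω φ hs hw
  have hh : (G.enthalpyDensity : ℂ) ≠ 0 := by exact_mod_cast G.enthalpyDensity_pos.ne'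
  have hd : (((damping K 1).re : ℝ) : ℂ) = damping K s := by
    rw [damping_re hK, damping_eq hJ hK hs]
  have hflux := hw.flux_isBigO hJ hK hs
  constructor
  · refine (hflux.const_mul_left (1 / 2)).congr' ?_ EventuallyEq.rfl
    filter_upwards [hw.spin] with k hk
    have hsp := G.mem_spinSpace_iff.mpr hk
    rw [shearStress12_eq_inner, flowVelocity2, momentumDensity2_eq_inner, inner_velocity_left,
      G.inner_coord_one hs hsp, G.inner_coord_one hs (G.velocity_mem_spinSpace hsp),
      Complex.ofReal_mul, hd]
    field_simp
  · have hne := hw.inner_shearMode_ne_zero hJ hK hs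
    have hcont : ContinuousAt (fun k => ⟪G.shearMode s, φ k⟫_ℂ) 0 :=
      (innerSL ℂ (G.shearMode s)).continuous.continuousAt.comp hw.analytic_state.continuousAt
    have h1 : (fun k : ℂ => (⟪G.shearMode s, φ k⟫_ℂ)⁻¹) =O[𝓝 0] fun _ => (1 : ℂ) :=
      (hcont.inv₀ hne).isBigO_one ℂ
    have h2 := h1.mul ((Asymptotics.isBigO_refl (fun k : ℂ => k) (𝓝 0)).mul hflux)
    refine h2.congr' ?_ (Eventually.of_forall fun k => by ring)
    filter_upwards [hw.momentum_conservation hJ, hcont.eventually_ne hne] with k h3 h4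
    rw [Complex.ofReal_mul, hd, mul_add, h3]
    field_simp

/-! ### Existence of shear waves -/

/-- Lyapunov–Schmidt: with φ = χ + ψ, pairing with χ forces ω = k l(ψ). What remains is a
fixed-point equation for ψ in the spin space, where this single scalar condition suffices because
the kernel is one-dimensional. -/
theorem exists_isShearWave (hs : s = 1 ∨ s = -1) :
    ∃ (ω : ℂ → ℂ) (φ : ℂ → G.H), G.IsShearWave J s ω φ := by
  set χ := G.shearMode s
  have hχs : χ ∈ G.spinSpace s := G.shearMode_mem_spinSpace hs
  have hKs : ∀ φ ∈ G.spinSpace s, K φ ∈ G.spinSpace s := fun φ hφ =>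
    reducedResolvent_mem_spinSpace hJ hK hφ
  have hKVs : ∀ φ ∈ G.spinSpace s, K (G.velocity φ) ∈ G.spinSpace s := fun φ hφ =>
    hKs _ (G.velocity_mem_spinSpace hφ)
  let Ks : G.spinSpace s →L[ℂ] G.spinSpace s :=
    (K.comp (G.spinSpace s).subtypeL).codRestrict _ fun φ => hKs φ φ.2
  let KVs : G.spinSpace s →L[ℂ] G.spinSpace s :=
    ((K.comp G.velocity).comp (G.spinSpace s).subtypeL).codRestrict _ fun φ => hKVs φ φ.2
  let l : G.spinSpace s →L[ℂ] ℂ :=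
    (⟪χ, χ⟫_ℂ)⁻¹ • ((innerSL ℂ χ).comp G.velocity).comp (G.spinSpace s).subtypeL
  obtain ⟨ψ, hψ, hfix⟩ := exists_analyticAt_fixedPoint (-Complex.I • ⟨_, hKVs χ hχs⟩)
    (-Complex.I • KVs) (Complex.I • Ks) l
  have hl : ∀ x, l x = (⟪χ, χ⟫_ℂ)⁻¹ * ⟪χ, G.velocity x⟫_ℂ := fun x => rfl
  have hψ' : AnalyticAt ℂ (fun k => (ψ k : G.H)) 0 :=
    ((G.spinSpace s).subtypeL.analyticAt _).comp hψ
  have hfix' : ∀ᶠ k in 𝓝 (0 : ℂ), (ψ k : G.H) =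
      K ((Complex.I * (k * l (ψ k))) • (ψ k : G.H) -
        (Complex.I * k) • G.velocity (χ + ψ k)) := by
    filter_upwards [hfix] with k hk
    have h1 := congrArg (Subtype.val : G.spinSpace s → G.H) hk
    refine h1.trans ?_
    change k • (-Complex.I • K (G.velocity χ) + -Complex.I • K (G.velocity (ψ k))
      + l (ψ k) • Complex.I • K (ψ k)) = _
    simp only [map_sub, map_smul, map_add]
    module
  have hψ0 : (ψ 0 : G.H) = 0 := by simpa using hfix'.self_of_nhds
  refine ⟨fun k => k * l (ψ k), fun k => χ + ψ k, ?_, analyticAt_const.add hψ', by simp, ?_, ?_, ?_⟩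
  · exact analyticAt_id.mul ((l.analyticAt _).comp hψ)
  · simpa [hψ0] using G.shearMode_ne_zero s
  · filter_upwards [hfix'] with k hk
    set x : G.H := (Complex.I * (k * l (ψ k))) • (ψ k : G.H) -
        (Complex.I * k) • G.velocity (χ + ψ k) with hx
    obtain ⟨hd, hJx⟩ := hK.apply_right x
    have hψd : (ψ k : G.H) ∈ J.domain := by rw [hk]; exact hd
    obtain ⟨hχd, hχ0⟩ := (hJ.ker_iff χ).mpr (G.shearMode_mem_hydro s)
    have hψP : G.hydro.starProjection (ψ k) = 0 := by
      rw [hk]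
      exact (Submodule.starProjection_apply_eq_zero_iff G.hydro).mpr (hK.mem_orthogonal x)
    have hJψ : J ⟨ψ k, hψd⟩ = x - G.hydro.starProjection x := by
      rw [← hJx]
      exact congrArg J (Subtype.ext hk)
    -- This is the solvability condition: the hydrodynamic part of ik v¹φ is exactly iωχ.
    have hPV : G.hydro.starProjection (G.velocity (χ + ψ k)) = l (ψ k) • χ := by
      rw [starProjection_eq_smul_shearMode hJ hK hs
        (G.velocity_mem_spinSpace ((G.spinSpace s).add_mem hχs (ψ k).2)), map_add,
        inner_add_right, G.inner_shearMode_velocity_self s, zero_add, hl, mul_comm, div_eq_mul_inv]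
    have hmain : J ⟨χ + ψ k, J.domain.add_mem hχd hψd⟩ =
        (Complex.I * (k * l (ψ k))) • (χ + ψ k) - (Complex.I * k) • G.velocity (χ + ψ k) := by
      have h1 : J ⟨χ + ψ k, J.domain.add_mem hχd hψd⟩ = J ⟨χ, hχd⟩ + J ⟨ψ k, hψd⟩ :=
        J.map_add ⟨χ, hχd⟩ ⟨ψ k, hψd⟩
      rw [h1, hχ0, hJψ, hx, map_sub, map_smul, map_smul, hψP, hPV]
      module
    refine ⟨J.domain.add_mem hχd hψd, ?_⟩
    rw [hmain]
    filter_upwards [Lp.coeFn_sub ((Complex.I * (k * l (ψ k))) • (χ + (ψ k : G.H)))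
        ((Complex.I * k) • G.velocity (χ + ψ k)),
      Lp.coeFn_smul (Complex.I * (k * l (ψ k))) (χ + (ψ k : G.H)),
      Lp.coeFn_smul (Complex.I * k) (G.velocity (χ + ψ k)),
      G.coeFn_velocity (χ + ψ k)] with p h2 h3 h4 h5
    rw [h2, Pi.sub_apply, h3, h4, Pi.smul_apply, Pi.smul_apply, h5, smul_eq_mul, smul_eq_mul]
    ring
  · exact Eventually.of_forall fun k =>
      G.mem_spinSpace_iff.mp ((G.spinSpace s).add_mem hχs (ψ k).2)

end Collision

/-! ### Uniqueness of the viscosity and conclusion -/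

theorem IsShearViscosity.unique {J : G.H →ₗ.[ℂ] G.H} {η η' : ℝ} (hs : s = 1 ∨ s = -1)
    {ω : ℂ → ℂ} {φ : ℂ → G.H} (hw : G.IsShearWave J s ω φ) (h : G.IsShearViscosity J η)
    (h' : G.IsShearViscosity J η') : η' = η := by
  have hh : (G.enthalpyDensity : ℂ) ≠ 0 := by exact_mod_cast G.enthalpyDensity_pos.ne'
  have h1 := (h' s ω φ hs hw).2.sub (h s ω φ hs hw).2
  set c : ℂ := Complex.I * (η' - η) / G.enthalpyDensity with hc
  have h2 : (fun k : ℂ => c * k ^ 2) =O[𝓝 0] fun k : ℂ => k ^ 3 :=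
    h1.congr_left fun k => by rw [hc]; ring
  -- Dividing by k² off the origin leaves a constant that is O(k), hence zero.
  have h3 : (fun _ : ℂ => c) =O[𝓝[≠] 0] fun k : ℂ => k := by
    have h4 := (h2.mono nhdsWithin_le_nhds).mul
      (Asymptotics.isBigO_refl (fun k : ℂ => (k ^ 2)⁻¹) (𝓝[≠] 0))
    refine h4.congr' ?_ ?_ <;> filter_upwards [self_mem_nhdsWithin] with k (hk : k ≠ 0) <;>
      field_simp
  have h4 : Tendsto (fun _ : ℂ => c) (𝓝[≠] 0) (𝓝 0) :=
    h3.trans_tendsto (tendsto_id.mono_left nhdsWithin_le_nhds)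
  have h5 : c = 0 := tendsto_nhds_unique tendsto_const_nhds h4
  rw [hc, div_eq_zero_iff, mul_eq_zero] at h5
  have h6 : (η' : ℂ) - η = 0 := by simpa [hh] using h5
  exact_mod_cast sub_eq_zero.mp h6

end Equilibrium

end KineticGas

end

theorem mainTheorem4 (G : KineticGas.Equilibrium) (J : G.H →ₗ.[ℂ] G.H)
    (hJ : G.IsCollisionOperator J) (τg : ℝ) (hgap : G.HasGap J τg) :
    (∀ s : ℤ, s = 1 ∨ s = -1 → ∃ (ω : ℂ → ℂ) (φ : ℂ → G.H), G.IsShearWave J s ω φ) ∧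
    ∃ η : ℝ, G.IsShearViscosity J η ∧
      (∀ η' : ℝ, G.IsShearViscosity J η' → η' = η) ∧
      η ≤ 32 / (3 * Real.pi) * G.enthalpyDensity * τg := by
  have := hJ.hasOrthogonalProjection
  obtain ⟨K, hK⟩ := KineticGas.Equilibrium.HasGap.exists_isReducedResolvent hJ hgap
  refine ⟨fun s hs => KineticGas.Equilibrium.exists_isShearWave hJ hK hs, _,
    KineticGas.Equilibrium.isShearViscosity_damping hJ hK, fun η' hη' => ?_, ?_⟩
  -- A wave must exist here, since otherwise every real number would vacuously be a shear viscosity.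
  · obtain ⟨ω, φ, hw⟩ := KineticGas.Equilibrium.exists_isShearWave hJ hK (s := 1) (Or.inl rfl)
    exact KineticGas.Equilibrium.IsShearViscosity.unique (Or.inl rfl) hw
      (KineticGas.Equilibrium.isShearViscosity_damping hJ hK) hη'
  -- Already π ≤ 4 gives 3π ≤ 12 < 32; the bound without this factor has been established.
  · have h1 : 1 ≤ 32 / (3 * Real.pi) := by
      rw [le_div_iff₀ (by positivity)]
      linarith [Real.pi_le_four]
    have h2 := mul_le_mul_of_nonneg_left
      (KineticGas.Equilibrium.damping_re_le hK hgap.1 1) G.enthalpyDensity_pos.le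
    refine h2.trans ?_
    rw [mul_assoc]
    exact le_mul_of_one_le_left (mul_nonneg G.enthalpyDensity_pos.le hgap.1.le) h1
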